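/- Let $\mathscr{E}$ be the ring of germs at the origin of smooth ($C^\infty$) functions $f(x,\lambda)$ from $\mathbb{R}^2$ to $\mathbb{R}$, and let $K=\mathbb{R}$. A monomial germ is a germ $x^i\lambda^j$ with $i,j\ge 0$. Let $\prec$ be a local order on the monomials, i.e. a strict total order such that $x^{i}\lambda^{j}\prec x^{i'}\lambda^{j'}$ implies $x^{i+p}\lambda^{j+q}\prec x^{i'+p}\lambda^{j'+q}$ for all $p,q\ge 0$, and such that $x\prec 1$ and $\lambda\prec 1$. For $f\in\mathscr{E}$ whose Taylor series at the origin $\sum a_{ij}x^i\lambda^j$ is non-zero, the leading term $LT(f)$ is the non-zero term $a_{ij}x^i\lambda^j$ of this series with the greatest monomial with respect to $\prec$; if the Taylor series is zero, $LT(f):=0$. For an ideal $I$ of $\mathscr{E}$, let $LT(I)_{\mathscr{E}}$ be the ideal of $\mathscr{E}$ generated by all $LT(f)$, $f\in I$. A standard basis of $I$ is a finite set $S\subseteq I$ that generates $I$ and satisfies $LT(I)_{\mathscr{E}}=\langle LT(g) : g\in S\rangle_{\mathscr{E}}$. The ideal $I$ has finite codimension if $\langle x,\lambda\rangle_{\mathscr{E}}^{\,k}\subseteq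 I$ for some $k\in\mathbb{N}$. Let $I$ be an ideal of finite codimension in $\mathscr{E}$, let $S$ be a standard basis of $I$ with respect to a local order $\prec$, and let $$B=\{\,w : w \text{ is a monomial germ},\ w\notin\langle LT(g) : g\in S\rangle_{\mathscr{E}}\,\}.$$ Then the classes $w+I$, $w\in B$ (indexed by $w\in B$), form a $K$-vector-space basis of $\mathscr{E}/I$. -/

import Mathlib

open Filter Topology
open scoped ContDiff Nat

noncomputable section

namespace SmoothGerms

/-- A function is smooth near the origin of the `(x, l)`-plane: it is `C^∞` on a whole neighbourhood
of the origin. (`ContDiffAt ℝ ∞ f 0` alone would allow the neighbourhood to shrink with the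
order of differentiation.) -/
def SmoothNear (f : ℝ × ℝ → ℝ) : Prop :=
  ∀ᶠ p in 𝓝 (0 : ℝ × ℝ), ContDiffAt ℝ ∞ f p

/-- The subring of germs at the origin that have a representative which is smooth near the
origin. -/
def germRing : Subring (Germ (𝓝 (0 : ℝ × ℝ)) ℝ) where
  carrier := {F | ∃ f : ℝ × ℝ → ℝ, SmoothNear f ∧ F = (f : Germ (𝓝 (0 : ℝ × ℝ)) ℝ)}
  mul_mem' := by
    rintro _ _ ⟨f, hf, rfl⟩ ⟨g, hg, rfl⟩
    refine ⟨f * g, ?_, rfl⟩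
    filter_upwards [hf, hg] with p h1 h2 using h1.mul h2
  one_mem' := ⟨1, Eventually.of_forall fun _ => contDiffAt_const, rfl⟩
  add_mem' := by
    rintro _ _ ⟨f, hf, rfl⟩ ⟨g, hg, rfl⟩
    refine ⟨f + g, ?_, rfl⟩
    filter_upwards [hf, hg] with p h1 h2 using h1.add h2
  zero_mem' := ⟨0, Eventually.of_forall fun _ => contDiffAt_const, rfl⟩
  neg_mem' := by
    rintro _ ⟨f, hf, rfl⟩
    refine ⟨-f, ?_, rfl⟩
    filter_upwards [hf] with p h1 using h1.neg

/-- The ring `𝓔` of germs at the origin of smooth real functions of `(x, l)`. -/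
abbrev E : Type := germRing

/-- The germ of a function that is smooth near the origin. -/
def toGerm (f : ℝ × ℝ → ℝ) (hf : SmoothNear f) : E := ⟨(f : Germ (𝓝 (0 : ℝ × ℝ)) ℝ), f, hf, rfl⟩

/-- The inclusion of the constants. -/
def constHom : ℝ →+* E where
  toFun c := toGerm (fun _ => c) (Eventually.of_forall fun _ => contDiffAt_const)
  map_one' := rfl
  map_mul' _ _ := rfl
  map_zero' := rfl
  map_add' _ _ := rfl

/-- `𝓔` as a real algebra (through the constants); in particular `𝓔` and all its quotients by
ideals are real vector spaces. -/
instance : Algebra ℝ E := constHom.toAlgebra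

/-- The germ of the coordinate function `x`. -/
def X : E := toGerm Prod.fst (Eventually.of_forall fun _ => contDiffAt_fst)

/-- The germ of the coordinate function `l` (the distinguished parameter). -/
def L : E := toGerm Prod.snd (Eventually.of_forall fun _ => contDiffAt_snd)

/-- The monomial germ `x ^ i * l ^ j` with exponent `(i, j)`. -/
def monom (a : ℕ × ℕ) : E := X ^ a.1 * L ^ a.2

/-- The partial derivative with respect to `x`. -/
def partialX (f : ℝ × ℝ → ℝ) : ℝ × ℝ → ℝ := fun p => fderiv ℝ f p (1, 0)

/-- The partial derivative with respect to `l`. -/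
def partialL (f : ℝ × ℝ → ℝ) : ℝ × ℝ → ℝ := fun p => fderiv ℝ f p (0, 1)

/-- The coefficient of `x ^ i * l ^ j` in the Taylor series of a function at the origin:
`(∂_x^i ∂_l^j f)(0, 0) / (i! j!)`. -/
def taylorCoeff (f : ℝ × ℝ → ℝ) (a : ℕ × ℕ) : ℝ :=
  (partialX^[a.1] (partialL^[a.2] f)) 0 / ((a.1)! * (a.2)!)

theorem partialX_congr {f g : ℝ × ℝ → ℝ} (h : f =ᶠ[𝓝 0] g) : partialX f =ᶠ[𝓝 0] partialX g := by
  filter_upwards [h.fderiv (𝕜 := ℝ)] with p hp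
  simp only [partialX, hp]

theorem partialL_congr {f g : ℝ × ℝ → ℝ} (h : f =ᶠ[𝓝 0] g) : partialL f =ᶠ[𝓝 0] partialL g := by
  filter_upwards [h.fderiv (𝕜 := ℝ)] with p hp
  simp only [partialL, hp]

theorem taylorCoeff_congr {f g : ℝ × ℝ → ℝ} (h : f =ᶠ[𝓝 0] g) : taylorCoeff f = taylorCoeff g := by
  have h1 : ∀ n, ∀ u v : ℝ × ℝ → ℝ, u =ᶠ[𝓝 0] v → partialX^[n] u =ᶠ[𝓝 0] partialX^[n] v := by
    intro n
    induction n with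
    | zero => exact fun _ _ h => h
    | succ n ih => exact fun u v h => ih _ _ (partialX_congr h)
  have h2 : ∀ n, ∀ u v : ℝ × ℝ → ℝ, u =ᶠ[𝓝 0] v → partialL^[n] u =ᶠ[𝓝 0] partialL^[n] v := by
    intro n
    induction n with
    | zero => exact fun _ _ h => h
    | succ n ih => exact fun u v h => ih _ _ (partialL_congr h)
  funext a
  simp only [taylorCoeff, (h1 a.1 _ _ (h2 a.2 _ _ h)).eq_of_nhds]

/-- The Taylor coefficients of a germ at the origin (those of any representative). -/
def coeff (F : E) : ℕ × ℕ → ℝ :=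
  Germ.liftOn (F : Germ (𝓝 (0 : ℝ × ℝ)) ℝ) taylorCoeff fun _ _ h => taylorCoeff_congr h

/-- A local order on the monomials `x ^ i * l ^ j`, given as the strict order `a ≺ b` of their
exponents `a, b : ℕ × ℕ`: a strict total order that is compatible with multiplication and in which
`x ≺ 1` and `l ≺ 1`. -/
structure IsLocalOrder (r : ℕ × ℕ → ℕ × ℕ → Prop) : Prop where
  strictTotal : IsStrictTotalOrder (ℕ × ℕ) r
  add_right : ∀ a b c : ℕ × ℕ, r a b → r (a + c) (b + c)
  x_lt_one : r (1, 0) (0, 0)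
  l_lt_one : r (0, 1) (0, 0)

/-- `a` is the exponent of the greatest term of the Taylor series of `F`. -/
def IsLeadingExponent (r : ℕ × ℕ → ℕ × ℕ → Prop) (F : E) (a : ℕ × ℕ) : Prop :=
  coeff F a ≠ 0 ∧ ∀ b, coeff F b ≠ 0 → b ≠ a → r b a

open Classical in
/-- The leading term `LT(F)` with respect to `r`: the greatest term of the Taylor series of `F`,
and `0` if `F` is flat. (For a local order, every non-flat germ has a greatest term.) -/
def leadingTerm (r : ℕ × ℕ → ℕ × ℕ → Prop) (F : E) : E :=
  if h : ∃ a, IsLeadingExponent r F a then coeff F h.choose • monom h.choose else 0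

/-- The leading term ideal `LT(I)` of an ideal. -/
def leadingTermIdeal (r : ℕ × ℕ → ℕ × ℕ → Prop) (I : Ideal E) : Ideal E :=
  Ideal.span (leadingTerm r '' (I : Set E))

/-- `S` is a standard basis of `I`: a finite generating set whose leading terms generate the leading
term ideal of `I`. -/
structure IsStandardBasis (r : ℕ × ℕ → ℕ × ℕ → Prop) (S : Set E) (I : Ideal E) : Prop where
  finite : S.Finite
  span_eq : Ideal.span S = I
  leadingTermIdeal_eq : leadingTermIdeal r I = Ideal.span (leadingTerm r '' S)

/-- `I` has finite codimension: it contains a power of the ideal `⟨x, l⟩`. -/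
def FiniteCodim (I : Ideal E) : Prop :=
  ∃ k : ℕ, Ideal.span {X, L} ^ k ≤ I

/-- The set `B` of the monomial germs that do not lie in the ideal generated by the leading terms of
the elements of `S`. -/
def standardMonomials (r : ℕ × ℕ → ℕ × ℕ → Prop) (S : Set E) : Set E :=
  {w | (∃ a, w = monom a) ∧ w ∉ Ideal.span (leadingTerm r '' S)}

end SmoothGerms

end

/-!
By Hadamard's lemma every germ is `c + x G + l H` with a constant `c` and smooth germs `G`, `H`;
iterating, a germ is its Taylor polynomial of degree `< k` modulo `⟨x, l⟩ ^ k`. Since multiplication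
by a monomial shifts Taylor coefficients, a germ in an ideal generated by monomials has only terms
divisible by one of the generators; hence the monomials in `LT(I)` are exactly the leading monomials
of the elements of `I`.

A linear relation modulo `I` between monomials of `B` is an element of `I` whose leading monomial,
if it had one, would lie both in `B` and in `LT(I)`; so the relation is trivial. Conversely, suppose
`⟨x, l⟩ ^ k ⊆ I`. A monomial of degree `< k` outside `B` is the leading monomial of some `F ∈ I`,
and the Taylor polynomial of `F` of degree `< k` is again in `I`, so this monomial is congruent
modulo `I` to a combination of smaller ones. As there are only finitely many monomials of degree
`< k`, well-founded induction shows that `B` spans `E / I`.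
-/

/-! ### Hadamard's lemma -/

section Calculus

universe u

theorem hasFDerivAt_intervalIntegral {V W : Type*} [NormedAddCommGroup V] [NormedSpace ℝ V]
    [NormedAddCommGroup W] [NormedSpace ℝ W] {h : V × ℝ → W} (hh : ContDiff ℝ 1 h) (a b : ℝ)
    (x : V) : HasFDerivAt (fun x => ∫ t in a..b, h (x, t))
      (∫ t in a..b, (fderiv ℝ h (x, t)).comp (ContinuousLinearMap.inl ℝ V ℝ)) x := by
  have hslice (y : V) : Continuous fun t : ℝ => (y, t) := by fun_prop
  have hderiv : Continuous fun q => (fderiv ℝ h q).comp (ContinuousLinearMap.inl ℝ V ℝ) :=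
    (hh.continuous_fderiv one_ne_zero).clm_comp_const _
  obtain ⟨C, hC⟩ := isCompact_uIcc.exists_bound_of_continuousOn (s := Set.uIcc a b)
    (hderiv.comp (hslice x)).continuousOn
  have hbound : ∀ᶠ y in 𝓝 x, ∀ t ∈ Set.uIcc a b,
      ‖(fderiv ℝ h (y, t)).comp (ContinuousLinearMap.inl ℝ V ℝ)‖ < C + 1 :=
    isCompact_uIcc.eventually_forall_of_forall_eventually fun t ht =>
      hderiv.norm.continuousAt.eventually_lt_const ((hC t ht).trans_lt (lt_add_one C))
  refine intervalIntegral.hasFDerivAt_integral_of_dominated_of_fderiv_le hbound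
    (F' := fun y t => (fderiv ℝ h (y, t)).comp (ContinuousLinearMap.inl ℝ V ℝ))
    (bound := fun _ => C + 1) ?_ ?_ ?_ ?_ intervalIntegrable_const ?_
  · exact .of_forall fun y => (hh.continuous.comp (hslice y)).aestronglyMeasurable
  · exact (hh.continuous.comp (hslice x)).intervalIntegrable _ _
  · exact (hderiv.comp (hslice x)).aestronglyMeasurable
  · exact .of_forall fun t ht y hy => (hy t (Set.uIoc_subset_uIcc ht)).le
  · exact .of_forall fun t _ y _ =>
      (hh.differentiable one_ne_zero (y, t)).hasFDerivAt.comp y (hasFDerivAt_prodMk_left y t)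

-- The induction replaces `W` by `V →L[ℝ] W`, so both spaces have to live in the same universe.
theorem contDiff_intervalIntegral {V W : Type u} [NormedAddCommGroup V] [NormedSpace ℝ V]
    [NormedAddCommGroup W] [NormedSpace ℝ W] {n : ℕ∞} {h : V × ℝ → W} (hh : ContDiff ℝ n h)
    (a b : ℝ) : ContDiff ℝ n fun x => ∫ t in a..b, h (x, t) := by
  refine contDiff_iff_forall_nat_le.2 fun m hm => ?_
  replace hh : ContDiff ℝ m h := hh.of_le (by exact_mod_cast hm)
  clear hm
  induction m generalizing W with
  | zero =>
    rw [Nat.cast_zero, contDiff_zero] at hh ⊢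
    exact intervalIntegral.continuous_parametric_intervalIntegral_of_continuous'
      (f := fun x t => h (x, t)) hh a b
  | succ m ih =>
    have hderiv := hasFDerivAt_intervalIntegral (hh.of_le (by simp)) a b
    rw [Nat.cast_succ, contDiff_succ_iff_fderiv]
    refine ⟨fun x => (hderiv x).differentiableAt, by simp, ?_⟩
    rw [funext fun x => (hderiv x).fderiv]
    exact ih ((hh.fderiv_right (by simp)).clm_comp contDiff_const)

theorem exists_contDiff_eq_add_apply_sub {V W : Type u} [NormedAddCommGroup V] [NormedSpace ℝ V]
    [NormedAddCommGroup W] [NormedSpace ℝ W] [CompleteSpace W] {n : ℕ∞} {f : V → W}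
    (hf : ContDiff ℝ (n + 1) f) (x₀ : V) :
    ∃ g : V → V →L[ℝ] W, ContDiff ℝ n g ∧ ∀ x, f x = f x₀ + g x (x - x₀) := by
  have hderiv : ContDiff ℝ n (fderiv ℝ f) := hf.fderiv_right le_rfl
  refine ⟨fun x => ∫ t in (0 : ℝ)..1, fderiv ℝ f (x₀ + t • (x - x₀)), ?_, fun x => ?_⟩
  · exact contDiff_intervalIntegral (h := fun q => fderiv ℝ f (x₀ + q.2 • (q.1 - x₀)))
      (hderiv.comp (by fun_prop)) 0 1
  · have hcont : Continuous fun t : ℝ => fderiv ℝ f (x₀ + t • (x - x₀)) :=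
      hderiv.continuous.comp (by fun_prop)
    have hline (t : ℝ) : HasDerivAt (fun t : ℝ => f (x₀ + t • (x - x₀)))
        (fderiv ℝ f (x₀ + t • (x - x₀)) (x - x₀)) t := by
      refine (hf.differentiable (by simp) _).hasFDerivAt.comp_hasDerivAt t ?_
      simpa using ((hasDerivAt_id t).smul_const (x - x₀)).const_add x₀
    have hftc : ∫ t in (0 : ℝ)..1, fderiv ℝ f (x₀ + t • (x - x₀)) (x - x₀) = f x - f x₀ := by
      simpa using intervalIntegral.integral_eq_sub_of_hasDerivAt (a := 0) (b := 1)
        (fun t _ => hline t) ((hcont.clm_apply continuous_const).intervalIntegrable 0 1)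
    beta_reduce
    rw [ContinuousLinearMap.intervalIntegral_apply (hcont.intervalIntegrable 0 1), hftc,
      add_sub_cancel]

theorem exists_contDiff_eventuallyEq {V W : Type*} [NormedAddCommGroup V] [NormedSpace ℝ V]
    [HasContDiffBump V] [NormedAddCommGroup W] [NormedSpace ℝ W] {n : ℕ∞} {f : V → W} {x₀ : V}
    (hf : ∀ᶠ x in 𝓝 x₀, ContDiffAt ℝ n f x) : ∃ g : V → W, ContDiff ℝ n g ∧ g =ᶠ[𝓝 x₀] f := by
  obtain ⟨ε, hε, hball⟩ := Metric.eventually_nhds_iff_ball.1 hf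
  let χ : ContDiffBump x₀ := ⟨ε / 4, ε / 2, by positivity, by linarith⟩
  refine ⟨fun x => χ x • f x, contDiff_iff_contDiffAt.2 fun x => ?_, ?_⟩
  · by_cases hx : x ∈ tsupport χ
    · rw [χ.tsupport_eq] at hx
      exact χ.contDiffAt.smul (hball x (Metric.closedBall_subset_ball (half_lt_self hε) hx))
    · have hzero : (fun y => χ y • f y) =ᶠ[𝓝 x] fun _ => 0 := by
        filter_upwards [notMem_tsupport_iff_eventuallyEq.1 hx] with y hy
        rw [hy, Pi.zero_apply, zero_smul]
      exact contDiffAt_const.congr_of_eventuallyEq hzero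
  · filter_upwards [χ.eventuallyEq_one] with x hx
    rw [hx, Pi.one_apply, one_smul]

end Calculus

theorem derivation_pow_mul {R A : Type*} [CommSemiring R] [CommSemiring A] [Algebra R A]
    (D : Derivation R A A) {y : A} {c : R} (hy : D y = algebraMap R A c) (n : ℕ) (z : A) :
    ((D : A →ₗ[R] A) ^ n) (y * z) =
      y * ((D : A →ₗ[R] A) ^ n) z + (n * c) • ((D : A →ₗ[R] A) ^ (n - 1)) z := by
  induction n with
  | zero => simp
  | succ n ih =>
    have hshift : (n * c) • D (((D : A →ₗ[R] A) ^ (n - 1)) z) =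
        (n * c) • ((D : A →ₗ[R] A) ^ n) z := by
      rcases n with _ | n
      · simp
      · rw [pow_succ' _ n]
        rfl
    rw [pow_succ', Module.End.mul_apply, ih, Module.End.mul_apply, Derivation.coeFn_coe, map_add,
      Derivation.leibniz, hy, Derivation.map_smul, hshift, Nat.add_sub_cancel, Nat.cast_succ,
      add_one_mul, add_smul, smul_eq_mul, smul_eq_mul, mul_comm _ (algebraMap R A c),
      ← Algebra.smul_def]
    abel

noncomputable section

namespace SmoothGerms

/-! ### Taylor coefficients -/

theorem exists_toGerm_eq (F : E) : ∃ f, ∃ hf : SmoothNear f, toGerm f hf = F := by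
  obtain ⟨F, f, hf, rfl⟩ := F
  exact ⟨f, hf, rfl⟩

theorem SmoothNear.fderiv_apply {f : ℝ × ℝ → ℝ} (hf : SmoothNear f) (v : ℝ × ℝ) :
    SmoothNear fun p => fderiv ℝ f p v := by
  filter_upwards [hf] with p hp
  exact (hp.fderiv_right (by simp)).clm_apply contDiffAt_const

theorem SmoothNear.eventually_differentiableAt {f : ℝ × ℝ → ℝ} (hf : SmoothNear f) :
    ∀ᶠ p in 𝓝 0, DifferentiableAt ℝ f p := by
  filter_upwards [hf] with p hp using hp.differentiableAt (by simp)

/-- The derivative in the direction `v` of a germ of functions at `x`. It is defined for all germs,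
with the junk value `0` at the points where a representative is not differentiable. -/
def germLineDeriv {V W : Type*} [NormedAddCommGroup V] [NormedSpace ℝ V] [NormedAddCommGroup W]
    [NormedSpace ℝ W] {x : V} (v : V) : Germ (𝓝 x) W → Germ (𝓝 x) W :=
  Germ.map' (fun f y => fderiv ℝ f y v) fun _ _ h => by
    filter_upwards [h.fderiv (𝕜 := ℝ)] with y hy
    rw [hy]

/-- The derivative of a smooth germ in the direction `v`, as a bare function; it is bundled as the
derivation `dirDeriv v`. -/
def dirDerivFun (v : ℝ × ℝ) (F : E) : E :=
  ⟨germLineDeriv v F, by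
    obtain ⟨f, hf, hF⟩ := F.2
    exact ⟨_, hf.fderiv_apply v, congr_arg (germLineDeriv v) hF⟩⟩

theorem dirDerivFun_add (v : ℝ × ℝ) (F G : E) :
    dirDerivFun v (F + G) = dirDerivFun v F + dirDerivFun v G := by
  obtain ⟨f, hf, rfl⟩ := exists_toGerm_eq F
  obtain ⟨g, hg, rfl⟩ := exists_toGerm_eq G
  refine Subtype.ext (Germ.coe_eq.2 ?_)
  filter_upwards [hf.eventually_differentiableAt, hg.eventually_differentiableAt] with p hfp hgp
  exact DFunLike.congr_fun (fderiv_add hfp hgp) v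

theorem dirDerivFun_mul (v : ℝ × ℝ) (F G : E) :
    dirDerivFun v (F * G) = F * dirDerivFun v G + G * dirDerivFun v F := by
  obtain ⟨f, hf, rfl⟩ := exists_toGerm_eq F
  obtain ⟨g, hg, rfl⟩ := exists_toGerm_eq G
  refine Subtype.ext (Germ.coe_eq.2 ?_)
  filter_upwards [hf.eventually_differentiableAt, hg.eventually_differentiableAt] with p hfp hgp
  exact DFunLike.congr_fun (fderiv_mul hfp hgp) v

theorem dirDerivFun_smul (v : ℝ × ℝ) (c : ℝ) (F : E) :
    dirDerivFun v (c • F) = c • dirDerivFun v F := by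
  obtain ⟨f, hf, rfl⟩ := exists_toGerm_eq F
  refine Subtype.ext (Germ.coe_eq.2 ?_)
  filter_upwards [hf.eventually_differentiableAt] with p hfp
  exact DFunLike.congr_fun (fderiv_const_mul hfp c) v

/-- The derivative of smooth germs in the direction `v`, as a derivation of `E`. -/
def dirDeriv (v : ℝ × ℝ) : Derivation ℝ E E :=
  Derivation.mk'
    { toFun := dirDerivFun v
      map_add' := dirDerivFun_add v
      map_smul' := dirDerivFun_smul v }
    (dirDerivFun_mul v)

theorem dirDeriv_X (v : ℝ × ℝ) : dirDeriv v X = algebraMap ℝ E v.1 :=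
  Subtype.ext <| Germ.coe_eq.2 <| .of_forall fun _ => by simp [fderiv_fst]

theorem dirDeriv_L (v : ℝ × ℝ) : dirDeriv v L = algebraMap ℝ E v.2 :=
  Subtype.ext <| Germ.coe_eq.2 <| .of_forall fun _ => by simp [fderiv_snd]

theorem coe_dirDeriv_pow (v : ℝ × ℝ) (n : ℕ) {F : E} {f : ℝ × ℝ → ℝ}
    (hF : (F : Germ (𝓝 (0 : ℝ × ℝ)) ℝ) = f) :
    ((((dirDeriv v : E →ₗ[ℝ] E) ^ n) F : E) : Germ (𝓝 (0 : ℝ × ℝ)) ℝ) =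
      ((fun g p => fderiv ℝ g p v)^[n] f : ℝ × ℝ → ℝ) := by
  induction n with
  | zero => exact hF
  | succ n ih =>
    rw [pow_succ', Module.End.mul_apply, Function.iterate_succ_apply']
    exact congr_arg (germLineDeriv v) ih

/-- The value of a smooth germ at the origin. -/
def evalZero : E →ₐ[ℝ] ℝ :=
  { Germ.valueRingHom.comp germRing.subtype with commutes' := fun _ => rfl }

/-- The Taylor coefficient `coeff · a` as a linear form on `E`. -/
def coeffLinear (a : ℕ × ℕ) : E →ₗ[ℝ] ℝ :=
  ((a.1 ! : ℝ) * a.2 !)⁻¹ • evalZero.toLinearMap ∘ₗ ((dirDeriv (1, 0) : E →ₗ[ℝ] E) ^ a.1) ∘ₗ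
    ((dirDeriv (0, 1) : E →ₗ[ℝ] E) ^ a.2)

theorem coeffLinear_apply (a : ℕ × ℕ) (F : E) : coeffLinear a F = coeff F a := by
  obtain ⟨f, hf, rfl⟩ := exists_toGerm_eq F
  have hderiv := coe_dirDeriv_pow (1, 0) a.1
    (coe_dirDeriv_pow (0, 1) a.2 (F := toGerm f hf) (f := f) rfl)
  exact (mul_comm _ _).trans (congr_arg (Germ.value · * _) hderiv)

theorem coeff_smul (c : ℝ) (F : E) (a : ℕ × ℕ) : coeff (c • F) a = c * coeff F a := by
  simp only [← coeffLinear_apply, map_smul, smul_eq_mul]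

theorem coeff_sum {ι : Type*} (s : Finset ι) (F : ι → E) (a : ℕ × ℕ) :
    coeff (∑ i ∈ s, F i) a = ∑ i ∈ s, coeff (F i) a := by
  simp only [← coeffLinear_apply, map_sum]

theorem coeff_eq_evalZero_div (F : E) (a : ℕ × ℕ) :
    coeff F a = evalZero (((dirDeriv (1, 0) : E →ₗ[ℝ] E) ^ a.1)
      (((dirDeriv (0, 1) : E →ₗ[ℝ] E) ^ a.2) F)) / (a.1 ! * a.2 !) := by
  rw [← coeffLinear_apply, div_eq_inv_mul]
  rfl

theorem evalZero_X : evalZero X = 0 := rfl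

theorem evalZero_L : evalZero L = 0 := rfl

theorem coeff_X_mul_zero (F : E) (j : ℕ) : coeff (X * F) (0, j) = 0 := by
  simp [coeff_eq_evalZero_div, derivation_pow_mul _ (dirDeriv_X (0, 1)), evalZero_X]

theorem coeff_X_mul_succ (F : E) (i j : ℕ) : coeff (X * F) (i + 1, j) = coeff F (i, j) := by
  simp only [coeff_eq_evalZero_div, derivation_pow_mul _ (dirDeriv_X _), map_add, map_mul, map_smul,
    evalZero_X, Nat.factorial_succ, smul_eq_mul, Nat.add_sub_cancel]
  push_cast
  field_simp
  ring

theorem coeff_L_mul_zero (F : E) (i : ℕ) : coeff (L * F) (i, 0) = 0 := by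
  simp [coeff_eq_evalZero_div, derivation_pow_mul _ (dirDeriv_L (1, 0)), evalZero_L]

theorem coeff_L_mul_succ (F : E) (i j : ℕ) : coeff (L * F) (i, j + 1) = coeff F (i, j) := by
  simp only [coeff_eq_evalZero_div, derivation_pow_mul _ (dirDeriv_L _), map_add, map_mul, map_smul,
    evalZero_L, Nat.factorial_succ, smul_eq_mul, Nat.add_sub_cancel]
  push_cast
  field_simp
  ring

theorem coeff_one (a : ℕ × ℕ) : coeff 1 a = if a = 0 then 1 else 0 := by
  have hpow (v : ℝ × ℝ) (n : ℕ) : ((dirDeriv v : E →ₗ[ℝ] E) ^ (n + 1)) 1 = 0 := by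
    rw [pow_succ, Module.End.mul_apply, Derivation.coeFn_coe, Derivation.map_one_eq_zero, map_zero]
  obtain ⟨_ | i, _ | j⟩ := a <;> simp [coeff_eq_evalZero_div, hpow]

theorem coeff_X_pow_mul (F : E) (n i j : ℕ) :
    coeff (X ^ n * F) (i, j) = if n ≤ i then coeff F (i - n, j) else 0 := by
  induction n generalizing i with
  | zero => simp
  | succ n ih =>
    rw [pow_succ', mul_assoc]
    rcases i with _ | i
    · simp [coeff_X_mul_zero]
    · simp [coeff_X_mul_succ, ih]

theorem coeff_L_pow_mul (F : E) (n i j : ℕ) :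
    coeff (L ^ n * F) (i, j) = if n ≤ j then coeff F (i, j - n) else 0 := by
  induction n generalizing j with
  | zero => simp
  | succ n ih =>
    rw [pow_succ', mul_assoc]
    rcases j with _ | j
    · simp [coeff_L_mul_zero]
    · simp [coeff_L_mul_succ, ih]

theorem coeff_monom_mul (c : ℕ × ℕ) (F : E) (a : ℕ × ℕ) :
    coeff (monom c * F) a = if c ≤ a then coeff F (a - c) else 0 := by
  obtain ⟨i, j⟩ := a
  obtain ⟨p, q⟩ := c
  rw [monom, mul_assoc, coeff_X_pow_mul, coeff_L_pow_mul, ← ite_and]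
  rfl

theorem coeff_monom (c a : ℕ × ℕ) : coeff (monom c) a = if a = c then 1 else 0 := by
  have hmul := coeff_monom_mul c 1 a
  rw [mul_one, coeff_one, ← ite_and] at hmul
  rw [hmul]
  refine if_congr ⟨fun ⟨hle, hsub⟩ => ?_, fun h => by simp [h]⟩ rfl rfl
  rw [← tsub_add_cancel_of_le hle, hsub, zero_add]

theorem monom_add (a b : ℕ × ℕ) : monom (a + b) = monom a * monom b := by
  simp only [monom, Prod.fst_add, Prod.snd_add]
  ring

/-! ### Monomial ideals and Taylor's formula -/

theorem coeff_linearCombination_monom (l : ℕ × ℕ →₀ ℝ) (a : ℕ × ℕ) :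
    coeff (Finsupp.linearCombination ℝ monom l) a = l a := by
  simp only [Finsupp.linearCombination_apply, Finsupp.sum, coeff_sum, coeff_smul, coeff_monom,
    mul_ite, mul_one, mul_zero]
  rw [Finset.sum_ite_eq, ite_eq_left_iff, Finsupp.notMem_support_iff]
  exact Eq.symm

theorem linearIndependent_monom : LinearIndependent ℝ monom := fun l l' h =>
  Finsupp.ext fun a => by
    rw [← coeff_linearCombination_monom, h, coeff_linearCombination_monom]

theorem exists_le_of_mem_span_monom_image {T : Set (ℕ × ℕ)} {F : E}
    (hF : F ∈ Ideal.span (monom '' T)) {a : ℕ × ℕ} (ha : coeff F a ≠ 0) : ∃ e ∈ T, e ≤ a := by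
  obtain ⟨l, hl, rfl⟩ := (Finsupp.mem_span_image_iff_linearCombination E).1 hF
  rw [Finsupp.linearCombination_apply, Finsupp.sum, coeff_sum] at ha
  obtain ⟨e, he, hne⟩ := Finset.exists_ne_zero_of_sum_ne_zero ha
  rw [smul_eq_mul, mul_comm, coeff_monom_mul] at hne
  exact ⟨e, hl he, by_contra fun hle => hne (if_neg hle)⟩

/-- The ideal `⟨x, l⟩`, which is the maximal ideal of the local ring `E`. -/
abbrev maxIdeal : Ideal E := Ideal.span {X, L}

theorem X_mem_maxIdeal : X ∈ maxIdeal := Ideal.subset_span (Set.mem_insert _ _)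

theorem L_mem_maxIdeal : L ∈ maxIdeal := Ideal.subset_span (Set.mem_insert_of_mem _ rfl)

theorem monom_zero : monom 0 = 1 := by simp [monom]

theorem monom_one_zero : monom (1, 0) = X := by simp [monom]

theorem monom_zero_one : monom (0, 1) = L := by simp [monom]

theorem maxIdeal_pow_le_span_monom (k : ℕ) :
    maxIdeal ^ k ≤ Ideal.span (monom '' {a | a.1 + a.2 = k}) := by
  induction k with
  | zero =>
    rw [pow_zero, Ideal.one_eq_top, top_le_iff, Ideal.eq_top_iff_one, ← monom_zero]
    exact Ideal.subset_span (Set.mem_image_of_mem _ rfl)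
  | succ k ih =>
    have hmul {a e : ℕ × ℕ} (ha : a.1 + a.2 = k) (he : e.1 + e.2 = 1) :
        monom a * monom e ∈ Ideal.span (monom '' {a | a.1 + a.2 = k + 1}) := by
      refine Ideal.subset_span ⟨a + e, ?_, monom_add a e⟩
      rw [Set.mem_ofPred_eq, Prod.fst_add, Prod.snd_add, ← ha, ← he, add_add_add_comm]
    refine (Ideal.mul_mono_left ih).trans ?_
    rw [Ideal.span_mul_span', Ideal.span_le]
    rintro _ ⟨_, ⟨a, ha, rfl⟩, _, rfl | rfl, rfl⟩
    · simpa only [monom_one_zero, SetLike.mem_coe] using hmul ha (e := (1, 0)) rfl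
    · simpa only [monom_zero_one, SetLike.mem_coe] using hmul ha (e := (0, 1)) rfl

theorem coeff_eq_zero_of_mem_maxIdeal_pow {k : ℕ} {F : E} (hF : F ∈ maxIdeal ^ k) {a : ℕ × ℕ}
    (ha : a.1 + a.2 < k) : coeff F a = 0 := by
  by_contra hne
  obtain ⟨e, rfl, hle⟩ := exists_le_of_mem_span_monom_image (maxIdeal_pow_le_span_monom k hF) hne
  exact ha.not_ge (add_le_add hle.1 hle.2)

theorem exists_eq_algebraMap_add_X_mul_add_L_mul (F : E) :
    ∃ (c : ℝ) (G H : E), F = algebraMap ℝ E c + X * G + L * H := by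
  obtain ⟨f₀, hf₀, rfl⟩ := exists_toGerm_eq F
  obtain ⟨f, hf, hff₀⟩ := exists_contDiff_eventuallyEq (n := ⊤) hf₀
  obtain ⟨g, hg, hfg⟩ := exists_contDiff_eq_add_apply_sub (n := ⊤) (f := f) (by exact hf) 0
  have hsmooth (v : ℝ × ℝ) : SmoothNear fun p => g p v :=
    .of_forall fun p => (hg.clm_apply contDiff_const).contDiffAt
  refine ⟨f 0, toGerm _ (hsmooth (1, 0)), toGerm _ (hsmooth (0, 1)), Subtype.ext <|
    Germ.coe_eq.2 ?_⟩
  filter_upwards [hff₀] with p hp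
  have hbasis : p = p.1 • (1, 0) + p.2 • (0, 1) := by ext <;> simp
  rw [← hp, hfg p, sub_zero]
  conv_lhs => enter [2, 2]; rw [hbasis]
  rw [map_add, map_smul, map_smul, ← add_assoc]
  rfl

/-- The exponents of the monomials of total degree less than `k`. -/
def exponentsBelow (k : ℕ) : Finset (ℕ × ℕ) :=
  {a ∈ Finset.range k ×ˢ Finset.range k | a.1 + a.2 < k}

theorem mem_exponentsBelow {k : ℕ} {a : ℕ × ℕ} : a ∈ exponentsBelow k ↔ a.1 + a.2 < k := by
  simp only [exponentsBelow, Finset.mem_filter, Finset.mem_product, Finset.mem_range]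
  omega

theorem monom_mul_mem_span {T U : Set (ℕ × ℕ)} {e : ℕ × ℕ} (h : Set.MapsTo (e + ·) T U) {P : E}
    (hP : P ∈ Submodule.span ℝ (monom '' T)) :
    monom e * P ∈ Submodule.span ℝ (monom '' U) := by
  have hle : Submodule.span ℝ (monom '' T) ≤
      (Submodule.span ℝ (monom '' U)).comap (LinearMap.mulLeft ℝ (monom e)) := by
    rw [Submodule.span_le]
    rintro _ ⟨a, ha, rfl⟩
    exact Submodule.subset_span ⟨e + a, h ha, monom_add e a⟩
  exact hle hP

theorem exists_mem_span_monom_sub_mem (k : ℕ) (F : E) :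
    ∃ P ∈ Submodule.span ℝ (monom '' (exponentsBelow k : Set (ℕ × ℕ))), F - P ∈ maxIdeal ^ k := by
  induction k generalizing F with
  | zero => exact ⟨0, zero_mem _, by simp⟩
  | succ k ih =>
    obtain ⟨c, G, H, rfl⟩ := exists_eq_algebraMap_add_X_mul_add_L_mul F
    obtain ⟨P, hP, hGP⟩ := ih G
    obtain ⟨Q, hQ, hHQ⟩ := ih H
    have hconst : algebraMap ℝ E c ∈
        Submodule.span ℝ (monom '' (exponentsBelow (k + 1) : Set (ℕ × ℕ))) := by
      rw [Algebra.algebraMap_eq_smul_one]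
      exact Submodule.smul_mem _ _ <| Submodule.subset_span
        ⟨0, mem_exponentsBelow.2 k.succ_pos, monom_zero⟩
    have hmaps {e : ℕ × ℕ} (he : e.1 + e.2 = 1) :
        Set.MapsTo (e + ·) (exponentsBelow k : Set (ℕ × ℕ)) (exponentsBelow (k + 1)) := by
      intro a ha
      simp only [Finset.mem_coe, mem_exponentsBelow, Prod.fst_add, Prod.snd_add] at ha ⊢
      lia
    have hXP := monom_mul_mem_span (hmaps (e := (1, 0)) rfl) hP
    have hLQ := monom_mul_mem_span (hmaps (e := (0, 1)) rfl) hQ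
    rw [monom_one_zero] at hXP
    rw [monom_zero_one] at hLQ
    refine ⟨_, add_mem (add_mem hconst hXP) hLQ, ?_⟩
    have hsub : algebraMap ℝ E c + X * G + L * H - (algebraMap ℝ E c + X * P + L * Q) =
        (G - P) * X + (H - Q) * L := by ring
    rw [hsub, pow_succ]
    exact add_mem (Ideal.mul_mem_mul hGP X_mem_maxIdeal) (Ideal.mul_mem_mul hHQ L_mem_maxIdeal)

/-- The Taylor polynomial at the origin of total degree less than `k`, as a linear map. -/
def taylorPolynomial (k : ℕ) : E →ₗ[ℝ] E :=
  ∑ a ∈ exponentsBelow k, (coeffLinear a).smulRight (monom a)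

theorem taylorPolynomial_apply (k : ℕ) (F : E) :
    taylorPolynomial k F = ∑ a ∈ exponentsBelow k, coeff F a • monom a := by
  simp [taylorPolynomial, coeffLinear_apply]

theorem taylorPolynomial_eq_zero {k : ℕ} {F : E} (hF : F ∈ maxIdeal ^ k) :
    taylorPolynomial k F = 0 := by
  rw [taylorPolynomial_apply]
  refine Finset.sum_eq_zero fun a ha => ?_
  rw [coeff_eq_zero_of_mem_maxIdeal_pow hF (mem_exponentsBelow.1 ha), zero_smul]

theorem taylorPolynomial_eq_self {k : ℕ} {P : E}
    (hP : P ∈ Submodule.span ℝ (monom '' (exponentsBelow k : Set (ℕ × ℕ)))) :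
    taylorPolynomial k P = P := by
  refine LinearMap.eqOn_span (g := LinearMap.id) ?_ hP
  rintro _ ⟨a, ha, rfl⟩
  simp [taylorPolynomial_apply, coeff_monom, Finset.mem_coe.1 ha]

theorem sub_taylorPolynomial_mem (k : ℕ) (F : E) : F - taylorPolynomial k F ∈ maxIdeal ^ k := by
  obtain ⟨P, hP, hFP⟩ := exists_mem_span_monom_sub_mem k F
  have hT : taylorPolynomial k F = P := by
    rw [← sub_add_cancel F P, map_add, taylorPolynomial_eq_zero hFP, taylorPolynomial_eq_self hP,
      zero_add]
  rwa [hT]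

/-! ### Leading exponents -/

variable {r : ℕ × ℕ → ℕ × ℕ → Prop}

theorem IsLeadingExponent.unique [Std.Asymm r] {F : E} {a b : ℕ × ℕ}
    (ha : IsLeadingExponent r F a) (hb : IsLeadingExponent r F b) : a = b :=
  by_contra fun hne => asymm_of r (ha.2 b hb.1 (Ne.symm hne)) (hb.2 a ha.1 hne)

theorem IsLeadingExponent.leadingTerm_eq [Std.Asymm r] {F : E} {a : ℕ × ℕ}
    (ha : IsLeadingExponent r F a) : leadingTerm r F = coeff F a • monom a := by
  have hex : ∃ b, IsLeadingExponent r F b := ⟨a, ha⟩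
  rw [leadingTerm, dif_pos hex, hex.choose_spec.unique ha]

theorem IsLeadingExponent.monom_mul (hadd : ∀ a b c, r a b → r (a + c) (b + c)) {F : E}
    {a : ℕ × ℕ} (ha : IsLeadingExponent r F a) (c : ℕ × ℕ) :
    IsLeadingExponent r (monom c * F) (a + c) := by
  refine ⟨by simpa [coeff_monom_mul] using ha.1, fun b hb hne => ?_⟩
  rw [coeff_monom_mul, ite_ne_right_iff] at hb
  obtain ⟨hle, hb⟩ := hb
  rw [← tsub_add_cancel_of_le hle] at hne ⊢
  exact hadd _ _ _ (ha.2 _ hb (ne_of_apply_ne (· + c) hne))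

theorem exists_isLeadingExponent [IsStrictTotalOrder (ℕ × ℕ) r] {F : E}
    (hfin : (Function.support (coeff F)).Finite) (hF : coeff F ≠ 0) :
    ∃ a, IsLeadingExponent r F a := by
  obtain ⟨a₀, ha₀⟩ := Function.support_nonempty_iff.2 hF
  obtain ⟨⟨a, ha⟩, -, hmax⟩ := WellFounded.has_min (hfin.wellFoundedOn (r := Function.swap r))
    Set.univ ⟨⟨a₀, ha₀⟩, trivial⟩
  refine ⟨a, ha, fun b hb hne => ?_⟩
  exact (trichotomous_of r b a).resolve_right (not_or.2 ⟨hne, hmax ⟨b, hb⟩ trivial⟩)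

theorem span_leadingTerm_image [Std.Asymm r] (S : Set E) :
    Ideal.span (leadingTerm r '' S) =
      Ideal.span (monom '' {a | ∃ F ∈ S, IsLeadingExponent r F a}) := by
  refine le_antisymm (Ideal.span_le.2 ?_) (Ideal.span_le.2 ?_)
  · rintro _ ⟨F, hF, rfl⟩
    by_cases hex : ∃ a, IsLeadingExponent r F a
    · obtain ⟨a, ha⟩ := hex
      rw [ha.leadingTerm_eq]
      exact Submodule.smul_of_tower_mem _ _ (Ideal.subset_span ⟨a, ⟨F, hF, ha⟩, rfl⟩)
    · rw [leadingTerm, dif_neg hex]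
      exact zero_mem _
  · rintro _ ⟨a, ⟨F, hF, ha⟩, rfl⟩
    rw [← inv_smul_smul₀ ha.1 (monom a), ← ha.leadingTerm_eq]
    exact Submodule.smul_of_tower_mem _ _ (Ideal.subset_span (Set.mem_image_of_mem _ hF))

theorem monom_mem_leadingTermIdeal_iff [Std.Asymm r]
    (hadd : ∀ a b c, r a b → r (a + c) (b + c)) {I : Ideal E} {a : ℕ × ℕ} :
    monom a ∈ leadingTermIdeal r I ↔ ∃ F ∈ I, IsLeadingExponent r F a := by
  rw [leadingTermIdeal, span_leadingTerm_image]
  refine ⟨fun h => ?_, fun h => Ideal.subset_span (Set.mem_image_of_mem _ h)⟩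
  obtain ⟨e, ⟨F, hF, he⟩, hle⟩ := exists_le_of_mem_span_monom_image h (a := a)
    (by simp [coeff_monom])
  refine ⟨monom (a - e) * F, I.mul_mem_left _ hF, ?_⟩
  simpa only [add_tsub_cancel_of_le hle] using he.monom_mul hadd (a - e)

/-! ### Standard monomials -/

theorem standardMonomials_coe_eq_image (r : ℕ × ℕ → ℕ × ℕ → Prop) (I : Ideal E) :
    standardMonomials r (I : Set E) = monom '' {a | monom a ∉ leadingTermIdeal r I} := by
  ext w
  constructor
  · rintro ⟨⟨a, rfl⟩, ha⟩
    exact ⟨a, ha, rfl⟩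
  · rintro ⟨a, ha, rfl⟩
    exact ⟨⟨a, rfl⟩, ha⟩

theorem eq_zero_of_mem_span_standardMonomials [IsStrictTotalOrder (ℕ × ℕ) r] {I : Ideal E} {F : E}
    (hF : F ∈ I)
    (hspan : F ∈ Submodule.span ℝ (standardMonomials r (I : Set E))) : F = 0 := by
  rw [standardMonomials_coe_eq_image] at hspan
  obtain ⟨l, hl, rfl⟩ := (Finsupp.mem_span_image_iff_linearCombination ℝ).1 hspan
  have hcoeff : coeff (Finsupp.linearCombination ℝ monom l) = l :=
    funext (coeff_linearCombination_monom l)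
  by_contra hne
  obtain ⟨a, ha⟩ := exists_isLeadingExponent (r := r)
    (F := Finsupp.linearCombination ℝ monom l) (by simp [hcoeff]) (by
      rw [hcoeff]
      exact fun h => hne (by rw [DFunLike.coe_injective h (a₂ := 0), map_zero]))
  have hmem : monom a ∈ leadingTermIdeal r I := by
    rw [leadingTermIdeal, span_leadingTerm_image]
    exact Ideal.subset_span ⟨a, ⟨_, hF, ha⟩, rfl⟩
  exact hl (Finsupp.mem_support_iff.2 (hcoeff ▸ ha.1)) hmem

theorem linearIndependent_mk_standardMonomials (r : ℕ × ℕ → ℕ × ℕ → Prop)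
    [IsStrictTotalOrder (ℕ × ℕ) r] (I : Ideal E) :
    LinearIndependent ℝ fun w : standardMonomials r (I : Set E) => Ideal.Quotient.mk I w := by
  have hmonom : LinearIndependent ℝ ((↑) : standardMonomials r (I : Set E) → E) :=
    linearIndependent_monom.linearIndepOn_id.mono fun w hw => hw.1.imp fun _ => Eq.symm
  refine hmonom.map (f := (Ideal.Quotient.mkₐ ℝ I).toLinearMap) (Submodule.disjoint_def.2 ?_)
  intro F hspan hker
  rw [Subtype.range_coe] at hspan
  exact eq_zero_of_mem_span_standardMonomials (Ideal.Quotient.eq_zero_iff_mem.1 hker) hspan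

theorem monom_mem_span_standardMonomials_sup [IsStrictTotalOrder (ℕ × ℕ) r]
    (hadd : ∀ a b c, r a b → r (a + c) (b + c)) {I : Ideal E} {k : ℕ}
    (hk : maxIdeal ^ k ≤ I) {a : ℕ × ℕ} (ha : a ∈ exponentsBelow k) :
    monom a ∈ Submodule.span ℝ (standardMonomials r (I : Set E)) ⊔ I.restrictScalars ℝ := by
  refine ((exponentsBelow k).wellFoundedOn (r := r)).induction ha
    (P := fun a => monom a ∈ _) fun a ha ih => ?_
  by_cases hstd : monom a ∈ leadingTermIdeal r I
  · obtain ⟨F, hF, hlead⟩ := (monom_mem_leadingTermIdeal_iff hadd).1 hstd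
    have hTaylor : taylorPolynomial k F ∈ I :=
      (I.sub_mem_iff_right hF).1 (hk (sub_taylorPolynomial_mem k F))
    rw [taylorPolynomial_apply, ← Finset.add_sum_erase _ _ ha] at hTaylor
    have hlower : ∑ b ∈ (exponentsBelow k).erase a, coeff F b • monom b ∈
        Submodule.span ℝ (standardMonomials r (I : Set E)) ⊔ I.restrictScalars ℝ := by
      refine Submodule.sum_mem _ fun b hb => ?_
      obtain ⟨hne, hb⟩ := Finset.mem_erase.1 hb
      by_cases hzero : coeff F b = 0
      · rw [hzero, zero_smul]
        exact zero_mem _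
      · exact Submodule.smul_mem _ _ (ih b hb (hlead.2 b hzero hne))
    rw [← Submodule.smul_mem_iff _ hlead.1]
    exact (Submodule.add_mem_iff_left _ hlower).1 (Submodule.mem_sup_right hTaylor)
  · exact Submodule.mem_sup_left (Submodule.subset_span ⟨⟨a, rfl⟩, hstd⟩)

theorem span_standardMonomials_sup_eq_top [IsStrictTotalOrder (ℕ × ℕ) r]
    (hadd : ∀ a b c, r a b → r (a + c) (b + c)) {I : Ideal E} (hI : FiniteCodim I) :
    Submodule.span ℝ (standardMonomials r (I : Set E)) ⊔ I.restrictScalars ℝ = ⊤ := by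
  obtain ⟨k, hk⟩ := hI
  refine Submodule.eq_top_iff'.2 fun F => ?_
  rw [← sub_add_cancel F (taylorPolynomial k F)]
  refine add_mem (Submodule.mem_sup_right (hk (sub_taylorPolynomial_mem k F))) ?_
  rw [taylorPolynomial_apply]
  exact Submodule.sum_mem _ fun a ha =>
    Submodule.smul_mem _ _ (monom_mem_span_standardMonomials_sup hadd hk ha)

theorem span_range_mk_standardMonomials [IsStrictTotalOrder (ℕ × ℕ) r]
    (hadd : ∀ a b c, r a b → r (a + c) (b + c)) {I : Ideal E} (hI : FiniteCodim I) :
    Submodule.span ℝ (Set.range fun w : standardMonomials r (I : Set E) => Ideal.Quotient.mk I w) =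
      ⊤ := by
  refine Submodule.eq_top_iff'.2 fun q => ?_
  obtain ⟨F, rfl⟩ := Ideal.Quotient.mk_surjective q
  obtain ⟨P, hP, G, hG, rfl⟩ := Submodule.mem_sup.1
    ((span_standardMonomials_sup_eq_top hadd hI).symm ▸ Submodule.mem_top (x := F))
  have hmap := Submodule.mem_map_of_mem (f := (Ideal.Quotient.mkₐ ℝ I).toLinearMap) hP
  rw [Submodule.map_span, Set.image_eq_range] at hmap
  rw [map_add, Ideal.Quotient.eq_zero_iff_mem.2 hG, add_zero]
  exact hmap

end SmoothGerms

end

/-- If `r` is not a local order, a germ that is not flat may fail to have a greatest term; its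
`leadingTerm` is then `0`, so that it contributes nothing to the two ideals in `hS`. -/
theorem mainTheorem8_general (r : ℕ × ℕ → ℕ × ℕ → Prop) [IsStrictTotalOrder (ℕ × ℕ) r]
    (hadd : ∀ a b c, r a b → r (a + c) (b + c)) (I : Ideal SmoothGerms.E)
    (hI : SmoothGerms.FiniteCodim I) (S : Set SmoothGerms.E)
    (hS : SmoothGerms.leadingTermIdeal r I = Ideal.span (SmoothGerms.leadingTerm r '' S)) :
    ∃ b : Module.Basis (SmoothGerms.standardMonomials r S) ℝ (SmoothGerms.E ⧸ I),
      ∀ w : SmoothGerms.standardMonomials r S, b w = Ideal.Quotient.mk I (w : SmoothGerms.E) := by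
  have hstd : SmoothGerms.standardMonomials r S = SmoothGerms.standardMonomials r (I : Set _) := by
    rw [SmoothGerms.standardMonomials, ← hS]
    rfl
  rw [hstd]
  exact ⟨.mk (SmoothGerms.linearIndependent_mk_standardMonomials r I)
    (SmoothGerms.span_range_mk_standardMonomials hadd hI).ge, Module.Basis.mk_apply _ _⟩

theorem mainTheorem8 (r : ℕ × ℕ → ℕ × ℕ → Prop) (hr : SmoothGerms.IsLocalOrder r)
    (I : Ideal SmoothGerms.E) (hI : SmoothGerms.FiniteCodim I)
    (S : Set SmoothGerms.E) (hS : SmoothGerms.IsStandardBasis r S I) :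
    ∃ b : Module.Basis (SmoothGerms.standardMonomials r S) ℝ (SmoothGerms.E ⧸ I),
      ∀ w : SmoothGerms.standardMonomials r S, b w = Ideal.Quotient.mk I (w : SmoothGerms.E) :=
  have := hr.strictTotal
  mainTheorem8_general r hr.add_right I hI S hS.leadingTermIdeal_eq
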